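/- Let $X\subseteq\mathbb R^d$ be Lebesgue measurable, with the $\sigma$-algebra of its Lebesgue measurable subsets, and let $\pi$ be a probability density on $X$ with respect to Lebesgue measure (also write $\pi$ for the corresponding distribution). For a proposal density $q(x,y)$ the Metropolis–Hastings kernel targeting $\pi$ is $$P(x,dy)=q(x,y)\,\alpha(x,y)\,dy+\Big[1-\int_X q(x,z)\,\alpha(x,z)\,dz\Big]\delta_x(dy),\qquad \alpha(x,y)=1\wedge\frac{\pi(y)q(y,x)}{\pi(x)q(x,y)}$$ for $x,y\in X$ (with $\alpha(x,y)=1$ if the denominator vanishes; proposals outside $X$ are rejected). A Markov kernel $P$ on $X$ with stationary distribution $\pi$ is called variance bounding if for every $h\in L^2(\pi)$ the asymptotic variance $$\lim_{n\to\infty} n\,\mathrm{Var}\Big[\frac1n\sum_{i=1}^n h(X_i)\Big]$$ exists and is finite, where $(X_i)_{i\ge1}$ is the Markov chain with kernel $P$ and $X_1\sim\pi$. Let $\lambda,\sigma>0$ and let $v:X\to\mathbb R^d$ be measurable with $\operatorname{ess\,sup}_\pi\|v\|<\infty$ (Euclidean norm). Let $P_{\mathrm{RWM}}$ be the Metropolis–Hastings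 kernel targeting $\pi$ whose proposal from $x$ is the normal distribution $\mathsf N(x,\lambda^2 I)$, that is, $q(x,y)\propto e^{-\|y-x\|^2/(2\lambda^2)}$, and let $P$ be the Metropolis–Hastings kernel targeting $\pi$ whose proposal from $x$ is $\mathsf N(x+v(x),\sigma^2 I)$, that is, $q(x,y)\propto e^{-\|y-x-v(x)\|^2/(2\sigma^2)}$. Then $P_{\mathrm{RWM}}$ is variance bounding if and only if $P$ is variance bounding. -/

import Mathlib

open MeasureTheory ProbabilityTheory Filter Topology
open scoped NNReal ENNReal

noncomputable section

/-! ## Stationary Markov chains, asymptotic variance, variance bounding -/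

section Chains

variable {S : Type*} [MeasurableSpace S]

/-- The law on `ℕ → S` of the time-homogeneous Markov chain `(X₀, X₁, …)` with transition kernel
`P` and `X₀ ∼ π`. -/
def chainLaw (P : Kernel S S) [IsMarkovKernel P] (π : Measure S) : Measure (ℕ → S) :=
  Kernel.trajMeasure (X := fun _ => S) π
    (fun n => P.comap
      (fun x : (Π _ : Finset.Iic n, S) => x ⟨n, Finset.mem_Iic.2 le_rfl⟩)
      (measurable_pi_apply _))

/-- `P` has the finite asymptotic variance `s` for `h`: with `X₀ ∼ π`, the sequence
`n * Var[(1/n) ∑_{i<n} h(X_i)]` converges to the real number `s`. -/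
def HasAsymptoticVariance (P : Kernel S S) [IsMarkovKernel P] (π : Measure S)
    (h : S → ℝ) (s : ℝ) : Prop :=
  Tendsto
    (fun n : ℕ => (n : ℝ) *
      variance (fun ω : ℕ → S => (1 / (n : ℝ)) * ∑ i ∈ Finset.range n, h (ω i)) (chainLaw P π))
    atTop (𝓝 s)

/-- A Markov kernel `P` with stationary distribution `π` is variance bounding if every
`h ∈ L²(π)` has a finite asymptotic variance. -/
def VarianceBounding (P : Kernel S S) [IsMarkovKernel P] (π : Measure S) : Prop :=
  ∀ h : S → ℝ, MemLp h 2 π → ∃ s : ℝ, HasAsymptoticVariance P π h s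

end Chains

/-! ## Metropolis-Hastings kernels with respect to a reference measure -/

section MetropolisHastings

/-- A probability density on `S` with respect to the reference measure `μ`. -/
structure TargetDensity (S : Type*) [MeasurableSpace S] (μ : Measure S) where
  dens : S → ℝ≥0
  measurable_dens : Measurable dens
  lintegral_dens : ∫⁻ x, (dens x : ℝ≥0∞) ∂μ = 1

/-- A proposal density `q(x, y)` on `S` with respect to the reference measure `μ`.  The total
mass of `q(x, ·)` over `S` may be less than one: this happens when `S` is a part of a larger space
in which the proposal is made, and proposals outside `S` are then rejected. -/
structure ProposalDensity (S : Type*) [MeasurableSpace S] (μ : Measure S) where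
  dens : S → S → ℝ≥0
  measurable_dens : Measurable (Function.uncurry dens)
  lintegral_dens_le : ∀ x, ∫⁻ y, (dens x y : ℝ≥0∞) ∂μ ≤ 1

variable {S : Type*} [MeasurableSpace S] {μ : Measure S}

/-- The target distribution, `π(dx) = π(x) μ(dx)`. -/
def TargetDensity.toMeasure (π : TargetDensity S μ) : Measure S :=
  μ.withDensity (fun x => (π.dens x : ℝ≥0∞))

/-- The acceptance probability `1 ∧ π(y)q(y,x) / (π(x)q(x,y))`, with the usual convention that it
is `1` when the denominator vanishes. -/
def mhAccept (π : TargetDensity S μ) (Q : ProposalDensity S μ) (x y : S) : ℝ≥0 :=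
  if π.dens x * Q.dens x y = 0 then 1
  else min 1 (π.dens y * Q.dens y x / (π.dens x * Q.dens x y))

/-- The probability, from `x`, that a move is proposed and accepted. -/
def mhMeanAccept (π : TargetDensity S μ) (Q : ProposalDensity S μ) (x : S) : ℝ≥0∞ :=
  ∫⁻ y, (Q.dens x y : ℝ≥0∞) * (mhAccept π Q x y : ℝ≥0∞) ∂μ

/-- The Metropolis-Hastings kernel
`P(x, dy) = q(x, y) α(x, y) μ(dy) + [1 - ∫ q(x, z) α(x, z) μ(dz)] δ_x(dy)`. -/
def mhKernel [SFinite μ] (π : TargetDensity S μ) (Q : ProposalDensity S μ) : Kernel S S :=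
  Kernel.withDensity (Kernel.const S μ)
      (fun x y => (Q.dens x y : ℝ≥0∞) * (mhAccept π Q x y : ℝ≥0∞))
    + Kernel.withDensity (Kernel.deterministic (id : S → S) measurable_id)
      (fun x _ => 1 - mhMeanAccept π Q x)

theorem measurable_mhAccept (π : TargetDensity S μ) (Q : ProposalDensity S μ) :
    Measurable (fun z : S × S => mhAccept π Q z.1 z.2) := by
  have h1 : Measurable (fun z : S × S => π.dens z.1) := π.measurable_dens.comp measurable_fst
  have h2 : Measurable (fun z : S × S => π.dens z.2) := π.measurable_dens.comp measurable_snd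
  have h3 : Measurable (fun z : S × S => Q.dens z.1 z.2) := Q.measurable_dens
  have h4 : Measurable (fun z : S × S => Q.dens z.2 z.1) :=
    Q.measurable_dens.comp measurable_swap
  unfold mhAccept
  exact Measurable.ite ((h1.mul h3) (measurableSet_singleton 0)) measurable_const
    (measurable_const.min ((h2.mul h4).div (h1.mul h3)))

theorem measurable_mhFlow (π : TargetDensity S μ) (Q : ProposalDensity S μ) :
    Measurable (Function.uncurry
      fun x y => (Q.dens x y : ℝ≥0∞) * (mhAccept π Q x y : ℝ≥0∞)) :=
  (Q.measurable_dens.coe_nnreal_ennreal).mul (measurable_mhAccept π Q).coe_nnreal_ennreal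

theorem measurable_mhMeanAccept [SFinite μ] (π : TargetDensity S μ) (Q : ProposalDensity S μ) :
    Measurable (mhMeanAccept π Q) :=
  (measurable_mhFlow π Q).lintegral_prod_right'

theorem mhAccept_le_one (π : TargetDensity S μ) (Q : ProposalDensity S μ) (x y : S) :
    mhAccept π Q x y ≤ 1 := by
  unfold mhAccept
  split_ifs
  · exact le_rfl
  · exact min_le_left _ _

theorem mhMeanAccept_le_one (π : TargetDensity S μ) (Q : ProposalDensity S μ) (x : S) :
    mhMeanAccept π Q x ≤ 1 := by
  refine le_trans (lintegral_mono fun y => ?_) (Q.lintegral_dens_le x)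
  exact mul_le_of_le_one_right' (ENNReal.coe_le_one_iff.2 (mhAccept_le_one π Q x y))

theorem mhKernel_apply [SFinite μ] (π : TargetDensity S μ) (Q : ProposalDensity S μ) (x : S)
    (A : Set S) :
    mhKernel π Q x A =
      ∫⁻ y in A, (Q.dens x y : ℝ≥0∞) * (mhAccept π Q x y : ℝ≥0∞) ∂μ
        + (1 - mhMeanAccept π Q x) * Measure.dirac x A := by
  have h2 : Measurable (Function.uncurry fun (x _ : S) => 1 - mhMeanAccept π Q x) :=
    (measurable_const.sub (measurable_mhMeanAccept π Q)).comp measurable_fst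
  rw [mhKernel, _root_.add_apply, Measure.add_apply,
    Kernel.withDensity_apply' _ (measurable_mhFlow π Q), Kernel.withDensity_apply' _ h2,
    Kernel.const_apply, Kernel.deterministic_apply, setLIntegral_const, id]

instance [SFinite μ] (π : TargetDensity S μ) (Q : ProposalDensity S μ) :
    IsMarkovKernel (mhKernel π Q) := by
  refine ⟨fun x => ⟨?_⟩⟩
  rw [mhKernel_apply π Q x Set.univ, Measure.restrict_univ, measure_univ, mul_one]
  exact add_tsub_cancel_of_le (mhMeanAccept_le_one π Q x)

end MetropolisHastings

/-! ## Lebesgue measurable subsets of `ℝ^d` and Gaussian proposals -/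

section Gaussian

variable {d : ℕ}

/-- The state space `X ⊆ ℝ^d` with the σ-algebra of all Lebesgue measurable subsets of `X`. -/
abbrev LebesgueSpace (X : Set (EuclideanSpace ℝ (Fin d))) : Type :=
  NullMeasurableSpace X (Measure.comap Subtype.val volume)

/-- The point of `ℝ^d` underlying a state. -/
def LebesgueSpace.pos {X : Set (EuclideanSpace ℝ (Fin d))} (x : LebesgueSpace X) :
    EuclideanSpace ℝ (Fin d) :=
  Subtype.val (p := fun z => z ∈ X) x

/-- Lebesgue measure on `X`. -/
def lebesgueOn (X : Set (EuclideanSpace ℝ (Fin d))) : Measure (LebesgueSpace X) :=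
  (Measure.comap Subtype.val volume : Measure X).completion

theorem LebesgueSpace.measurable_pos {X : Set (EuclideanSpace ℝ (Fin d))} :
    Measurable (LebesgueSpace.pos (X := X)) :=
  fun _ hs => (measurable_subtype_coe hs).nullMeasurableSet

theorem lebesgueOn_preimage_le (X : Set (EuclideanSpace ℝ (Fin d)))
    {s : Set (EuclideanSpace ℝ (Fin d))} (hs : MeasurableSet s) :
    lebesgueOn X (LebesgueSpace.pos ⁻¹' s) ≤ volume s := by
  change (Measure.comap Subtype.val volume : Measure X) (Subtype.val ⁻¹' s) ≤ volume s
  by_cases h : Function.Injective (Subtype.val : X → EuclideanSpace ℝ (Fin d)) ∧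
      ∀ t : Set X, MeasurableSet t → NullMeasurableSet (Subtype.val '' t) volume
  · rw [Measure.comap_apply₀ _ _ h.1 h.2 (measurable_subtype_coe hs).nullMeasurableSet]
    exact measure_mono (Set.image_preimage_subset _ _)
  · rw [Measure.comap, dif_neg h]
    simp

instance (X : Set (EuclideanSpace ℝ (Fin d))) : SigmaFinite (lebesgueOn X) := by
  refine ⟨⟨⟨fun n => LebesgueSpace.pos ⁻¹'
    spanningSets (volume : Measure (EuclideanSpace ℝ (Fin d))) n, fun _ => trivial,
    fun n => ?_, ?_⟩⟩⟩
  · exact (lebesgueOn_preimage_le X (measurableSet_spanningSets _ n)).trans_lt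
      (measure_spanningSets_lt_top _ n)
  · rw [← Set.preimage_iUnion, iUnion_spanningSets, Set.preimage_univ]

/-- The density of the normal distribution `N(m, σ² I)` on `ℝ^d` at `y`. -/
def gaussianDensity (m : EuclideanSpace ℝ (Fin d)) (σ : ℝ) (y : EuclideanSpace ℝ (Fin d)) : ℝ :=
  (2 * Real.pi * σ ^ 2) ^ (-(d : ℝ) / 2) * Real.exp (-(1 / (2 * σ ^ 2)) * ‖y - m‖ ^ 2)

theorem lintegral_gaussianDensity (m : EuclideanSpace ℝ (Fin d)) {σ : ℝ} (hσ : 0 < σ) :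
    ∫⁻ y, ENNReal.ofReal (gaussianDensity m σ y) = 1 := by
  have hb : 0 < 1 / (2 * σ ^ 2) := by positivity
  have h0 := GaussianFourier.integral_rexp_neg_mul_sq_norm
    (V := EuclideanSpace ℝ (Fin d)) hb
  have hpos : 0 < 2 * Real.pi * σ ^ 2 := by positivity
  have hint : ∫ y, gaussianDensity m σ y = 1 := by
    unfold gaussianDensity
    rw [integral_const_mul, integral_sub_right_eq_self
      (fun y : EuclideanSpace ℝ (Fin d) => Real.exp (-(1 / (2 * σ ^ 2)) * ‖y‖ ^ 2)) m, h0,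
      finrank_euclideanSpace_fin,
      show Real.pi / (1 / (2 * σ ^ 2)) = 2 * Real.pi * σ ^ 2 by field_simp,
      ← Real.rpow_add hpos]
    simp [neg_div]
  have hI : Integrable (gaussianDensity (d := d) m σ) := by
    by_contra h
    rw [integral_undef h] at hint
    exact zero_ne_one hint
  rw [← ofReal_integral_eq_lintegral_ofReal hI
    (Eventually.of_forall fun y => by unfold gaussianDensity; positivity), hint,
    ENNReal.ofReal_one]

/-- The proposal from `x ∈ X` is `N(x + v(x), σ² I)` on `ℝ^d`:
`q(x, y) ∝ exp(-‖y - x - v(x)‖² / (2σ²))`. -/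
def gaussianProposal (X : Set (EuclideanSpace ℝ (Fin d)))
    (v : LebesgueSpace X → EuclideanSpace ℝ (Fin d)) (hv : Measurable v)
    (σ : ℝ) (hσ : 0 < σ) : ProposalDensity (LebesgueSpace X) (lebesgueOn X) where
  dens x y := (gaussianDensity (x.pos + v x) σ y.pos).toNNReal
  measurable_dens := by
    have h1 : Measurable (fun z : LebesgueSpace X × LebesgueSpace X =>
        z.2.pos - (z.1.pos + v z.1)) :=
      (LebesgueSpace.measurable_pos.comp measurable_snd).sub
        ((LebesgueSpace.measurable_pos.comp measurable_fst).add (hv.comp measurable_fst))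
    unfold gaussianDensity
    exact (measurable_const.mul
      (Real.measurable_exp.comp (measurable_const.mul (h1.norm.pow_const 2)))).real_toNNReal
  lintegral_dens_le x := by
    have hmap : (lebesgueOn X).map LebesgueSpace.pos ≤ volume :=
      Measure.le_iff.2 fun s hs => by
        rw [Measure.map_apply LebesgueSpace.measurable_pos hs]
        exact lebesgueOn_preimage_le X hs
    have hm : Measurable fun y => ENNReal.ofReal (gaussianDensity (x.pos + v x) σ y) := by
      unfold gaussianDensity
      fun_prop
    calc ∫⁻ y : LebesgueSpace X, ((gaussianDensity (x.pos + v x) σ y.pos).toNNReal : ℝ≥0∞)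
          ∂(lebesgueOn X)
        = ∫⁻ y, ENNReal.ofReal (gaussianDensity (x.pos + v x) σ y)
            ∂((lebesgueOn X).map LebesgueSpace.pos) :=
          (lintegral_map hm LebesgueSpace.measurable_pos).symm
      _ ≤ ∫⁻ y, ENNReal.ofReal (gaussianDensity (x.pos + v x) σ y) :=
          lintegral_mono' hmap le_rfl
      _ = 1 := lintegral_gaussianDensity _ hσ

/-- The Gaussian random walk proposal: from `x ∈ X` the proposal is `N(x, σ² I)`. -/
def rwmProposal (X : Set (EuclideanSpace ℝ (Fin d))) (σ : ℝ) (hσ : 0 < σ) :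
    ProposalDensity (LebesgueSpace X) (lebesgueOn X) :=
  gaussianProposal X (fun _ => 0) measurable_const σ hσ

end Gaussian

end

/-! For any kernel with invariant distribution `π`, variance bounding is equivalent to coercivity
of `1 - P` on the mean-zero part of `L²(π)`, that is, to a Poincaré inequality. If `1 - P` is
coercive, every centred `f` can be written as `g - P g`, so that its partial sums are those of a
stationary martingale difference sequence up to two bounded terms (Gordin), and the asymptotic
variance is `‖g‖² - ‖P g‖²`. Conversely, if all asymptotic variances are finite, Banach-Steinhaus
bounds the partial sums by `C √n ‖f‖` uniformly in `f`; a function of small energy moves too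
slowly along the chain for that.

Poincaré inequalities for Metropolis-Hastings kernels can be compared through the proposals. Two
Gaussian proposals with bounded drifts have comparable densities on moves of bounded length, and
longer moves are so rare that their contribution to the energy is absorbed by the variance. -/

/-! ## Martingale approximation in Hilbert space -/

section MarkovDilation

variable {E K : Type*} [NormedAddCommGroup E] [InnerProductSpace ℝ E]
  [NormedAddCommGroup K] [InnerProductSpace ℝ K]

/-- The isometries `U n` dilate the powers of `P` as the evaluations of a stationary Markov chain
do: `U n f` stands for `f(Xₙ)`, and the identity is the weak form of the Markov property
`𝔼[g(Xₙ₊₁) | X₀, …, Xₙ] = (P g)(Xₙ)`. -/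
def IsMarkovDilation (P : E →L[ℝ] E) (U : ℕ → E →ₗᵢ[ℝ] K) : Prop :=
  ∀ ⦃i n⦄, i ≤ n → ∀ f g, inner ℝ (U i f) (U (n + 1) g) = inner ℝ (U i f) (U n (P g))

theorem sum_apply_sub_eq {A B F : Type*} [AddCommGroup A] [AddCommGroup B] [FunLike F A B]
    [AddMonoidHomClass F A B] (U : ℕ → F) (n : ℕ) (a b : A) :
    ∑ i ∈ Finset.range n, U i (a - b) =
      ∑ i ∈ Finset.range n, (U (i + 1) a - U i b) - (U n a - U 0 a) := by
  rw [← Finset.sum_range_sub (U · a), ← Finset.sum_sub_distrib]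
  refine Finset.sum_congr rfl fun i _ => ?_
  rw [map_sub]
  abel

theorem exists_sub_eq_of_isCoercive [CompleteSpace E] {P : E →L[ℝ] E}
    (hP : IsCoercive ((innerSL ℝ).comp (.id ℝ E - P))) (f : E) : ∃ g, g - P g = f := by
  obtain ⟨g, hg⟩ := hP.continuousLinearEquivOfBilin.surjective f
  refine ⟨g, (hP.unique_continuousLinearEquivOfBilin fun w => ?_).trans hg⟩
  rfl

theorem exists_norm_sum_le_mul_sqrt [CompleteSpace E] (T : ℕ → E →L[ℝ] K)
    (hT : ∀ f, BddAbove (Set.range fun n : ℕ => ‖∑ i ∈ Finset.range n, T i f‖ ^ 2 / n)) :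
    ∃ C, ∀ (n : ℕ) f, ‖∑ i ∈ Finset.range n, T i f‖ ≤ C * √n * ‖f‖ := by
  let S (n : ℕ) : E →L[ℝ] K := (√(n : ℝ))⁻¹ • ∑ i ∈ Finset.range n, T i
  have hS (n : ℕ) (f : E) : ‖S n f‖ = (√(n : ℝ))⁻¹ * ‖∑ i ∈ Finset.range n, T i f‖ := by
    simp only [S, smul_apply, sum_apply, norm_smul,
      norm_inv, Real.norm_eq_abs, abs_of_nonneg (Real.sqrt_nonneg _)]
  obtain ⟨C, hC⟩ : ∃ C, ∀ n, ‖S n‖ ≤ C := banach_steinhaus fun f => by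
    obtain ⟨c, hc⟩ := hT f
    refine ⟨√c, fun n => Real.le_sqrt_of_sq_le ?_⟩
    rw [hS, mul_pow, inv_pow, Real.sq_sqrt n.cast_nonneg, ← div_eq_inv_mul]
    exact hc ⟨n, rfl⟩
  refine ⟨C, fun n f => ?_⟩
  rcases n.eq_zero_or_pos with rfl | hn
  · simp
  have hn : 0 < √(n : ℝ) := by positivity
  have h := (S n).le_of_opNorm_le (hC n) f
  rw [hS, inv_mul_le_iff₀ hn] at h
  linarith

namespace IsMarkovDilation

variable {P : E →L[ℝ] E} {U : ℕ → E →ₗᵢ[ℝ] K}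

theorem norm_succ_sub_sq (h : IsMarkovDilation P U) (i : ℕ) (f : E) :
    ‖U (i + 1) f - U i f‖ ^ 2 = 2 * inner ℝ (f - P f) f := by
  rw [norm_sub_sq_real, real_inner_comm, h le_rfl, (U i).inner_map_map, (U i).norm_map,
    (U (i + 1)).norm_map, inner_sub_left, real_inner_self_eq_norm_sq, real_inner_comm f]
  ring

theorem norm_sub_zero_le (h : IsMarkovDilation P U) (n : ℕ) (f : E) :
    ‖U n f - U 0 f‖ ≤ n * √(2 * inner ℝ (f - P f) f) := by
  have hstep (i : ℕ) : dist (U i f) (U (i + 1) f) = √(2 * inner ℝ (f - P f) f) := by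
    rw [← h.norm_succ_sub_sq i, Real.sqrt_sq (norm_nonneg _), dist_comm, dist_eq_norm]
  calc ‖U n f - U 0 f‖ = dist (U 0 f) (U n f) := by rw [dist_comm, dist_eq_norm]
    _ ≤ ∑ i ∈ Finset.range n, dist (U i f) (U (i + 1) f) := dist_le_range_sum_dist (U · f) n
    _ = n * √(2 * inner ℝ (f - P f) f) := by
      simp only [hstep, Finset.sum_const, Finset.card_range, nsmul_eq_mul]

theorem mul_norm_le (h : IsMarkovDilation P U) (n : ℕ) (f : E) :
    n * ‖f‖ ≤ ‖∑ i ∈ Finset.range n, U i f‖ + n ^ 2 * √(2 * inner ℝ (f - P f) f) := by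
  set ε := √(2 * inner ℝ (f - P f) f)
  have hsum : n • U 0 f =
      ∑ i ∈ Finset.range n, U i f - ∑ i ∈ Finset.range n, (U i f - U 0 f) := by
    simp only [Finset.sum_sub_distrib, Finset.sum_const, Finset.card_range, sub_sub_cancel]
  have hdrift : ‖∑ i ∈ Finset.range n, (U i f - U 0 f)‖ ≤ n ^ 2 * ε := by
    calc ‖∑ i ∈ Finset.range n, (U i f - U 0 f)‖
        ≤ ∑ _i ∈ Finset.range n, n * ε := norm_sum_le_of_le _ fun i hi => by
          refine (h.norm_sub_zero_le i f).trans ?_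
          gcongr
          exact (Finset.mem_range.1 hi).le
      _ = n ^ 2 * ε := by
        rw [Finset.sum_const, Finset.card_range, nsmul_eq_mul]
        ring
  calc n * ‖f‖ = ‖n • U 0 f‖ := by rw [RCLike.norm_nsmul ℝ, (U 0).norm_map, nsmul_eq_mul]
    _ ≤ ‖∑ i ∈ Finset.range n, U i f‖ + ‖∑ i ∈ Finset.range n, (U i f - U 0 f)‖ := by
      rw [hsum]
      exact norm_sub_le _ _
    _ ≤ ‖∑ i ∈ Finset.range n, U i f‖ + n ^ 2 * ε := by gcongr

theorem inner_martingaleDifference (h : IsMarkovDilation P U) {i n : ℕ} (hi : i ≤ n) (f g : E) :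
    inner ℝ (U i f) (U (n + 1) g - U n (P g)) = 0 := by
  rw [inner_sub_right, h hi, sub_self]

theorem norm_martingaleDifference_sq (h : IsMarkovDilation P U) (n : ℕ) (g : E) :
    ‖U (n + 1) g - U n (P g)‖ ^ 2 = ‖g‖ ^ 2 - ‖P g‖ ^ 2 := by
  rw [norm_sub_sq_real, real_inner_comm, h le_rfl, real_inner_self_eq_norm_sq, (U n).norm_map,
    (U (n + 1)).norm_map]
  ring

theorem norm_sum_martingaleDifference_sq (h : IsMarkovDilation P U) (n : ℕ) (g : E) :
    ‖∑ i ∈ Finset.range n, (U (i + 1) g - U i (P g))‖ ^ 2 = n * (‖g‖ ^ 2 - ‖P g‖ ^ 2) := by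
  induction n with
  | zero => simp
  | succ n ih =>
    have horth : inner ℝ (∑ i ∈ Finset.range n, (U (i + 1) g - U i (P g)))
        (U (n + 1) g - U n (P g)) = 0 := by
      rw [sum_inner]
      refine Finset.sum_eq_zero fun i hi => ?_
      have hi := Finset.mem_range.1 hi
      rw [inner_sub_left, h.inner_martingaleDifference hi, h.inner_martingaleDifference hi.le,
        sub_zero]
    rw [Finset.sum_range_succ, norm_add_sq_real, horth, ih, h.norm_martingaleDifference_sq]
    push_cast
    ring

theorem tendsto_norm_sum_sub_sq_div (h : IsMarkovDilation P U) (g : E) :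
    Tendsto (fun n : ℕ => ‖∑ i ∈ Finset.range n, U i (g - P g)‖ ^ 2 / n) atTop
      (𝓝 (‖g‖ ^ 2 - ‖P g‖ ^ 2)) := by
  have hs : 0 ≤ ‖g‖ ^ 2 - ‖P g‖ ^ 2 := by
    rw [← h.norm_martingaleDifference_sq 0]
    positivity
  set s := √(‖g‖ ^ 2 - ‖P g‖ ^ 2) with hs_def
  have hclose (n : ℕ) : |‖∑ i ∈ Finset.range n, U i (g - P g)‖ - √n * s| ≤ 2 * ‖g‖ := by
    have hM : ‖∑ i ∈ Finset.range n, (U (i + 1) g - U i (P g))‖ = √n * s := by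
      rw [hs_def, ← Real.sqrt_mul n.cast_nonneg, ← h.norm_sum_martingaleDifference_sq,
        Real.sqrt_sq (norm_nonneg _)]
    rw [← hM]
    refine (abs_norm_sub_norm_le _ _).trans ?_
    rw [sum_apply_sub_eq, sub_sub_cancel_left, norm_neg]
    refine (norm_sub_le _ _).trans_eq ?_
    rw [(U n).norm_map, (U 0).norm_map, two_mul]
  have hsqrt : Tendsto (fun n : ℕ => √(n : ℝ)) atTop atTop :=
    Real.tendsto_sqrt_atTop.comp tendsto_natCast_atTop_atTop
  have hlim : Tendsto (fun n : ℕ => ‖∑ i ∈ Finset.range n, U i (g - P g)‖ / √n) atTop (𝓝 s) := by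
    refine tendsto_iff_dist_tendsto_zero.2 <| squeeze_zero'
      (Eventually.of_forall fun _ => dist_nonneg) ?_ (hsqrt.const_div_atTop (2 * ‖g‖))
    filter_upwards [eventually_gt_atTop 0] with n hn
    have hn : 0 < √(n : ℝ) := by positivity
    rw [Real.dist_eq, div_sub' hn.ne', abs_div, abs_of_pos hn]
    gcongr
    exact hclose n
  have := hlim.pow 2
  simpa only [div_pow, Real.sq_sqrt (Nat.cast_nonneg _), hs_def, Real.sq_sqrt hs] using this

/-- Since `f(Xᵢ)` drifts from `f(X₀)` by at most `i √(2⟪f - P f, f⟫)`, a sum over a suitable fixed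
number of steps would have norm of order `n ‖f‖` if `⟪f - P f, f⟫` were small. -/
theorem isCoercive_of_bddAbove [CompleteSpace E] (h : IsMarkovDilation P U)
    (hbdd : ∀ f, BddAbove (Set.range fun n : ℕ => ‖∑ i ∈ Finset.range n, U i f‖ ^ 2 / n)) :
    IsCoercive ((innerSL ℝ).comp (.id ℝ E - P)) := by
  obtain ⟨C, hC⟩ := exists_norm_sum_le_mul_sqrt (fun n => (U n).toContinuousLinearMap) hbdd
  obtain ⟨m, hm⟩ := exists_nat_gt (max 0 (2 * C))
  obtain ⟨hm0, hCm⟩ := max_lt_iff.1 hm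
  refine ⟨(8 * (m : ℝ) ^ 4)⁻¹, by positivity, fun f => ?_⟩
  set ε : ℝ := inner ℝ (f - P f) f with hε
  have hε0 : 0 ≤ 2 * ε := by
    rw [hε, ← h.norm_succ_sub_sq 0]
    positivity
  have hsum : ‖∑ i ∈ Finset.range (m ^ 2), U i f‖ ≤ (m : ℝ) ^ 2 / 2 * ‖f‖ := by
    refine (hC (m ^ 2) f).trans ?_
    gcongr
    rw [Nat.cast_pow, Real.sqrt_sq hm0.le]
    nlinarith
  have hnorm : ‖f‖ ≤ 2 * (m : ℝ) ^ 2 * √(2 * ε) := by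
    have := h.mul_norm_le (m ^ 2) f
    push_cast at this
    refine le_of_mul_le_mul_left ?_ (by positivity : 0 < (m : ℝ) ^ 2)
    linarith
  have hsq : ‖f‖ * ‖f‖ ≤ 8 * (m : ℝ) ^ 4 * ε := by
    calc ‖f‖ * ‖f‖ ≤ (2 * (m : ℝ) ^ 2 * √(2 * ε)) * (2 * (m : ℝ) ^ 2 * √(2 * ε)) := by gcongr
      _ = 4 * (m : ℝ) ^ 4 * (√(2 * ε) * √(2 * ε)) := by ring
      _ = 8 * (m : ℝ) ^ 4 * ε := by rw [Real.mul_self_sqrt hε0]; ring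
  rw [mul_assoc, inv_mul_le_iff₀ (by positivity)]
  exact hsq

theorem isCoercive_iff [CompleteSpace E] (h : IsMarkovDilation P U) :
    IsCoercive ((innerSL ℝ).comp (.id ℝ E - P)) ↔ ∀ f, ∃ s : ℝ,
      Tendsto (fun n : ℕ => ‖∑ i ∈ Finset.range n, U i f‖ ^ 2 / n) atTop (𝓝 s) := by
  refine ⟨fun hcoer f => ?_, fun hlim => h.isCoercive_of_bddAbove fun f => ?_⟩
  · obtain ⟨g, rfl⟩ : ∃ g, g - P g = f := exists_sub_eq_of_isCoercive hcoer f
    exact ⟨_, h.tendsto_norm_sum_sub_sq_div g⟩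
  · obtain ⟨s, hs⟩ := hlim f
    exact hs.bddAbove_range

end IsMarkovDilation

end MarkovDilation

/-! ## Markov operators and Poincaré inequalities -/

section MarkovOperator

variable {S : Type*} [MeasurableSpace S] {P : Kernel S S} [IsMarkovKernel P] {π : Measure S}

theorem measurePreserving_fst_compProd [SFinite π] :
    MeasurePreserving Prod.fst (π ⊗ₘ P) π :=
  ⟨measurable_fst, Measure.fst_compProd π P⟩

theorem measurePreserving_snd_compProd [SFinite π] (hinv : P.Invariant π) :
    MeasurePreserving Prod.snd (π ⊗ₘ P) π :=
  ⟨measurable_snd, (Measure.snd_compProd π P).trans hinv.def⟩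

/-- The operator `g ↦ ∫ g(y) P(·, dy)` on `L²(π)`. It is encoded as `A* B`, where `A` and `B` embed
`L²(π)` as the functions of the first and of the second coordinate of one stationary step, so
that no representative has to be integrated; see `coeFn_markovOperator`. -/
noncomputable def markovOperator [SFinite π] (hinv : P.Invariant π) : Lp ℝ 2 π →L[ℝ] Lp ℝ 2 π :=
  (Lp.compMeasurePreservingₗᵢ ℝ Prod.fst
    (measurePreserving_fst_compProd (P := P))).toContinuousLinearMap.adjoint.comp
  (Lp.compMeasurePreservingₗᵢ ℝ Prod.snd
    (measurePreserving_snd_compProd hinv)).toContinuousLinearMap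

theorem inner_markovOperator [SFinite π] (hinv : P.Invariant π) (f g : Lp ℝ 2 π) :
    inner ℝ f (markovOperator hinv g) =
      inner ℝ (Lp.compMeasurePreserving Prod.fst (measurePreserving_fst_compProd (P := P)) f)
        (Lp.compMeasurePreserving Prod.snd (measurePreserving_snd_compProd hinv) g) := by
  rw [markovOperator, ContinuousLinearMap.comp_apply, ContinuousLinearMap.adjoint_inner_right]
  rfl

theorem coeFn_markovOperator [IsFiniteMeasure π] (hinv : P.Invariant π) (g : Lp ℝ 2 π) :
    markovOperator hinv g =ᵐ[π] fun x => ∫ y, g y ∂P x := by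
  have hsnd : MeasurePreserving Prod.snd (π ⊗ₘ P) π := measurePreserving_snd_compProd hinv
  have hint : Integrable (fun z : S × S => g z.2) (π ⊗ₘ P) :=
    ((Lp.memLp g).comp_measurePreserving hsnd).integrable one_le_two
  refine Integrable.ae_eq_of_forall_setIntegral_eq _ _ ((Lp.memLp _).integrable one_le_two)
    (hint.integral_compProd (κ := Kernel.const Unit π) (a := ())) fun s hs _ => ?_
  calc ∫ x in s, markovOperator hinv g x ∂π
      = inner ℝ (indicatorConstLp 2 hs (measure_ne_top π s) (1 : ℝ)) (markovOperator hinv g) :=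
        (L2.inner_indicatorConstLp_one hs _ _).symm
    _ = ∫ z in Prod.fst ⁻¹' s, Lp.compMeasurePreserving Prod.snd hsnd g z ∂(π ⊗ₘ P) := by
        rw [inner_markovOperator, Lp.indicatorConstLp_compMeasurePreserving,
          L2.inner_indicatorConstLp_one]
    _ = ∫ z in s ×ˢ Set.univ, g z.2 ∂(π ⊗ₘ P) := by
        rw [Set.prod_univ]
        exact integral_congr_ae (ae_restrict_of_ae (Lp.coeFn_compMeasurePreserving g hsnd))
    _ = ∫ x in s, ∫ y, g y ∂P x ∂π := by
        rw [Measure.setIntegral_compProd hs .univ hint.integrableOn]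
        simp only [Measure.restrict_univ]

variable (π) in
/-- The subspace of `L²(π)` of functions with mean zero. -/
noncomputable def centeredL2 [IsFiniteMeasure π] : Submodule ℝ (Lp ℝ 2 π) :=
  (ℝ ∙ (indicatorConstLp 2 MeasurableSet.univ (measure_ne_top π Set.univ) (1 : ℝ)))ᗮ

instance [IsFiniteMeasure π] : CompleteSpace (centeredL2 π) :=
  inferInstanceAs (CompleteSpace (ℝ ∙ _)ᗮ)

theorem mem_centeredL2 [IsFiniteMeasure π] {f : Lp ℝ 2 π} :
    f ∈ centeredL2 π ↔ ∫ x, f x ∂π = 0 := by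
  rw [centeredL2, Submodule.mem_orthogonal_singleton_iff_inner_right,
    L2.inner_indicatorConstLp_one, setIntegral_univ]

theorem toLp_mem_centeredL2 [IsFiniteMeasure π] {f : S → ℝ} (hf : MemLp f 2 π) :
    hf.toLp ∈ centeredL2 π ↔ ∫ x, f x ∂π = 0 := by
  rw [mem_centeredL2, integral_congr_ae hf.coeFn_toLp]

theorem markovOperator_mem_centeredL2 [IsFiniteMeasure π] (hinv : P.Invariant π) {f : Lp ℝ 2 π}
    (hf : f ∈ centeredL2 π) : markovOperator hinv f ∈ centeredL2 π := by
  rw [centeredL2, Submodule.mem_orthogonal_singleton_iff_inner_right] at hf ⊢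
  rw [inner_markovOperator]
  exact ((Lp.compMeasurePreservingₗᵢ ℝ Prod.snd
    (measurePreserving_snd_compProd hinv)).inner_map_map _ f).trans hf

/-- The Markov operator on functions with mean zero. -/
noncomputable def centeredOperator [IsFiniteMeasure π] (hinv : P.Invariant π) :
    centeredL2 π →L[ℝ] centeredL2 π :=
  (markovOperator hinv).restrict fun _ => markovOperator_mem_centeredL2 hinv

end MarkovOperator

section Poincare

variable {S : Type*} [MeasurableSpace S] {P : Kernel S S} [IsMarkovKernel P] {π : Measure S}

/-- The quadratic form `∬ |f(x) - f(y)|² π(dx) P(x, dy)`, which is twice the Dirichlet form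
`⟪f - P f, f⟫` when `π` is invariant. -/
noncomputable def dirichletEnergy (P : Kernel S S) (π : Measure S) (f : S → ℝ) : ℝ≥0∞ :=
  ∫⁻ z, ‖f z.1 - f z.2‖ₑ ^ 2 ∂(π ⊗ₘ P)

/-- The energy of the kernel `P` controls the variance under `π`; for reversible `P` this means
that `1 - P` has a spectral gap on the mean-zero functions. -/
def PoincareInequality (P : Kernel S S) (π : Measure S) : Prop :=
  ∃ c : ℝ≥0, 0 < c ∧ ∀ f : S → ℝ, Measurable f → MemLp f 2 π → ∫ x, f x ∂π = 0 →
    c * ∫⁻ x, ‖f x‖ₑ ^ 2 ∂π ≤ dirichletEnergy P π f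

theorem ofReal_norm_toLp_sq {f : S → ℝ} (hf : MemLp f 2 π) :
    ENNReal.ofReal (‖hf.toLp‖ ^ 2) = ∫⁻ x, ‖f x‖ₑ ^ 2 ∂π := by
  have h := eLpNorm_nnreal_pow_eq_lintegral (μ := π) (f := f) (p := 2) two_ne_zero
  rw [ENNReal.ofReal_pow (norm_nonneg _), ofReal_norm, Lp.enorm_toLp]
  simpa using h

theorem norm_sub_compMeasurePreserving_sq [SFinite π] (hinv : P.Invariant π) (f : Lp ℝ 2 π) :
    ‖Lp.compMeasurePreserving Prod.fst (measurePreserving_fst_compProd (P := P)) f -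
        Lp.compMeasurePreserving Prod.snd (measurePreserving_snd_compProd hinv) f‖ ^ 2 =
      2 * inner ℝ (f - markovOperator hinv f) f := by
  rw [norm_sub_sq_real, Lp.norm_compMeasurePreserving, Lp.norm_compMeasurePreserving,
    ← inner_markovOperator hinv, inner_sub_left, real_inner_self_eq_norm_sq, real_inner_comm f]
  ring

theorem dirichletEnergy_toLp [SFinite π] (hinv : P.Invariant π) {f : S → ℝ} (hf : MemLp f 2 π) :
    dirichletEnergy P π f =
      ENNReal.ofReal (2 * inner ℝ (hf.toLp - markovOperator hinv hf.toLp) hf.toLp) := by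
  have hfst := hf.comp_measurePreserving (measurePreserving_fst_compProd (P := P))
  have hsnd := hf.comp_measurePreserving (measurePreserving_snd_compProd hinv)
  rw [dirichletEnergy, ← norm_sub_compMeasurePreserving_sq, Lp.toLp_compMeasurePreserving,
    Lp.toLp_compMeasurePreserving, ← MemLp.toLp_sub hfst hsnd, ofReal_norm_toLp_sq]
  rfl

theorem mul_lintegral_le_dirichletEnergy_iff [SFinite π] (hinv : P.Invariant π) {f : S → ℝ}
    (hf : MemLp f 2 π) (c : ℝ≥0) :
    c * ∫⁻ x, ‖f x‖ₑ ^ 2 ∂π ≤ dirichletEnergy P π f ↔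
      c * ‖hf.toLp‖ ^ 2 ≤ 2 * inner ℝ (hf.toLp - markovOperator hinv hf.toLp) hf.toLp := by
  have hnonneg : 0 ≤ 2 * inner ℝ (hf.toLp - markovOperator hinv hf.toLp) hf.toLp := by
    rw [← norm_sub_compMeasurePreserving_sq hinv]
    positivity
  rw [dirichletEnergy_toLp hinv hf, ← ofReal_norm_toLp_sq hf, ← ENNReal.ofReal_coe_nnreal,
    ← ENNReal.ofReal_mul c.coe_nonneg, ENNReal.ofReal_le_ofReal_iff hnonneg]

theorem poincareInequality_iff_isCoercive [IsFiniteMeasure π] (hinv : P.Invariant π) :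
    PoincareInequality P π ↔
      IsCoercive ((innerSL ℝ).comp (.id ℝ (centeredL2 π) - centeredOperator hinv)) := by
  constructor
  · rintro ⟨c, hc, hgap⟩
    refine ⟨c / 2, by positivity, fun f => ?_⟩
    have h := (mul_lintegral_le_dirichletEnergy_iff hinv (Lp.memLp (f : Lp ℝ 2 π)) c).1 <|
      hgap f (Lp.stronglyMeasurable _).measurable (Lp.memLp _) (mem_centeredL2.1 f.2)
    rw [Lp.toLp_coeFn] at h
    change (c / 2 : ℝ) * ‖(f : Lp ℝ 2 π)‖ * ‖(f : Lp ℝ 2 π)‖ ≤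
      inner ℝ ((f : Lp ℝ 2 π) - markovOperator hinv f) f
    linarith
  · rintro ⟨c, hc, hcoer⟩
    refine ⟨(2 * c).toNNReal, by simpa using hc, fun f _ hf hf0 => ?_⟩
    have h : c * ‖hf.toLp‖ * ‖hf.toLp‖ ≤
        inner ℝ (hf.toLp - markovOperator hinv hf.toLp) hf.toLp :=
      hcoer ⟨hf.toLp, (toLp_mem_centeredL2 hf).2 hf0⟩
    rw [mul_lintegral_le_dirichletEnergy_iff hinv hf, Real.coe_toNNReal _ (by positivity)]
    linarith

end Poincare

/-! ## Variance bounding and the Poincaré inequality -/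

section ChainLaw

variable {S : Type*} [MeasurableSpace S] {P : Kernel S S} [IsMarkovKernel P]
  {π : Measure S}

theorem map_eval_zero_chainLaw : (chainLaw P π).map (fun ω => ω 0) = π := by
  have h : (fun ω : ℕ → S => ω 0) =
      (fun x : (Π _ : Finset.Iic 0, S) => x ⟨0, Finset.mem_Iic.2 le_rfl⟩) ∘
        Preorder.frestrictLe (π := fun _ => S) 0 := rfl
  rw [h, ← Measure.map_map (by fun_prop) (by fun_prop), chainLaw, Kernel.trajMeasure,
    Measure.map_comp _ _ (by fun_prop), Kernel.traj_map_frestrictLe, Kernel.partialTraj_self,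
    Measure.id_comp, Measure.map_map (by fun_prop) (by fun_prop)]
  exact Measure.map_id

variable [IsProbabilityMeasure π]

instance : IsProbabilityMeasure (chainLaw P π) := by
  unfold chainLaw
  infer_instance

theorem map_frestrictLe_chainLaw_compProd (n : ℕ) :
    (chainLaw P π).map (Preorder.frestrictLe (π := fun _ => S) n) ⊗ₘ
      (P.comap (fun x : (Π _ : Finset.Iic n, S) => x ⟨n, Finset.mem_Iic.2 le_rfl⟩)
        (measurable_pi_apply _)) =
      (chainLaw P π).map (fun ω => (Preorder.frestrictLe (π := fun _ => S) n ω, ω (n + 1))) :=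
  Kernel.map_frestrictLe_trajMeasure_compProd_eq_map_trajMeasure

theorem map_eval_succ_chainLaw (n : ℕ) :
    (chainLaw P π).map (fun ω => ω (n + 1)) = P ∘ₘ (chainLaw P π).map (fun ω => ω n) := by
  have h := congrArg Measure.snd (map_frestrictLe_chainLaw_compProd (P := P) (π := π) n)
  rw [Measure.snd_map_prodMk (by fun_prop), Measure.snd_compProd,
    ← Kernel.comp_deterministic_eq_comap, ← Measure.comp_assoc,
    Measure.deterministic_comp_eq_map, Measure.map_map (by fun_prop) (by fun_prop)] at h
  exact h.symm

theorem measurePreserving_eval_chainLaw (hinv : P.Invariant π) (n : ℕ) :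
    MeasurePreserving (fun ω : ℕ → S => ω n) (chainLaw P π) π := by
  refine ⟨by fun_prop, ?_⟩
  induction n with
  | zero => exact map_eval_zero_chainLaw
  | succ n ih => rw [map_eval_succ_chainLaw, ih, hinv.def]

theorem integral_chainLaw_succ {E : Type*} [NormedAddCommGroup E] [NormedSpace ℝ E] (n : ℕ)
    {G : (Π _ : Finset.Iic n, S) × S → E} (hG : StronglyMeasurable G)
    (hint : Integrable (fun ω => G (Preorder.frestrictLe n ω, ω (n + 1))) (chainLaw P π)) :
    ∫ ω, G (Preorder.frestrictLe n ω, ω (n + 1)) ∂chainLaw P π =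
      ∫ ω, ∫ y, G (Preorder.frestrictLe n ω, y) ∂P (ω n) ∂chainLaw P π := by
  have hr : Measurable (Preorder.frestrictLe (π := fun _ => S) n) := by fun_prop
  have hpair : Measurable fun ω : ℕ → S =>
      (Preorder.frestrictLe (π := fun _ => S) n ω, ω (n + 1)) := by fun_prop
  have hint' := (integrable_map_measure hG.aestronglyMeasurable hpair.aemeasurable).2 hint
  have : IsProbabilityMeasure ((chainLaw P π).map (Preorder.frestrictLe (π := fun _ => S) n)) :=
    Measure.isProbabilityMeasure_map hr.aemeasurable
  rw [← integral_map hpair.aemeasurable hG.aestronglyMeasurable]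
  rw [← map_frestrictLe_chainLaw_compProd] at hint' ⊢
  rw [Measure.integral_compProd hint', integral_map hr.aemeasurable
    hG.integral_kernel_prod_right'.aestronglyMeasurable]
  rfl

/-- Evaluation at time `n`, as an isometry from `L²(π)` to `L²` of the path space. -/
noncomputable def evalL2 (hinv : P.Invariant π) (n : ℕ) :
    Lp ℝ 2 π →ₗᵢ[ℝ] Lp ℝ 2 (chainLaw P π) :=
  Lp.compMeasurePreservingₗᵢ ℝ _ (measurePreserving_eval_chainLaw hinv n)

theorem coeFn_evalL2 (hinv : P.Invariant π) (n : ℕ) (f : Lp ℝ 2 π) :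
    evalL2 hinv n f =ᵐ[chainLaw P π] fun ω => f (ω n) :=
  Lp.coeFn_compMeasurePreserving f (measurePreserving_eval_chainLaw hinv n)

theorem inner_evalL2 (hinv : P.Invariant π) (i j : ℕ) (f g : Lp ℝ 2 π) :
    inner ℝ (evalL2 hinv i f) (evalL2 hinv j g) = ∫ ω, f (ω i) * g (ω j) ∂chainLaw P π := by
  rw [L2.inner_def]
  refine integral_congr_ae ?_
  filter_upwards [coeFn_evalL2 hinv i f, coeFn_evalL2 hinv j g] with ω hf hg
  rw [hf, hg, RCLike.inner_apply', conj_trivial]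

theorem isMarkovDilation_evalL2 (hinv : P.Invariant π) :
    IsMarkovDilation (markovOperator hinv) (evalL2 hinv) := by
  intro i n hi f g
  have hf := (Lp.stronglyMeasurable f).measurable
  have hg := (Lp.stronglyMeasurable g).measurable
  have hG : Measurable fun z : (Π _ : Finset.Iic n, S) × S =>
      f (z.1 ⟨i, Finset.mem_Iic.2 hi⟩) * g z.2 := by fun_prop
  have hint : Integrable (fun ω : ℕ → S => f (ω i) * g (ω (n + 1))) (chainLaw P π) :=
    ((Lp.memLp f).comp_measurePreserving (measurePreserving_eval_chainLaw hinv i)).integrable_mul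
      ((Lp.memLp g).comp_measurePreserving (measurePreserving_eval_chainLaw hinv (n + 1)))
  calc inner ℝ (evalL2 hinv i f) (evalL2 hinv (n + 1) g)
      = ∫ ω, f (ω i) * g (ω (n + 1)) ∂chainLaw P π := inner_evalL2 hinv _ _ f g
    _ = ∫ ω, ∫ y, f (ω i) * g y ∂P (ω n) ∂chainLaw P π :=
        integral_chainLaw_succ n hG.stronglyMeasurable hint
    _ = ∫ ω, f (ω i) * markovOperator hinv g (ω n) ∂chainLaw P π := by
        refine integral_congr_ae ?_
        filter_upwards [(measurePreserving_eval_chainLaw hinv n).quasiMeasurePreserving.ae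
          (coeFn_markovOperator hinv g)] with ω hω
        rw [hω, integral_const_mul]
    _ = inner ℝ (evalL2 hinv i f) (evalL2 hinv n (markovOperator hinv g)) :=
        (inner_evalL2 hinv _ _ f _).symm

end ChainLaw

section VarianceBounding

variable {S : Type*} [MeasurableSpace S] {P : Kernel S S} [IsMarkovKernel P]
  {π : Measure S} [IsProbabilityMeasure π]

theorem norm_sq_eq_variance {Ω : Type*} [MeasurableSpace Ω] {μ : Measure Ω} {F : Lp ℝ 2 μ}
    (hF : ∫ ω, F ω ∂μ = 0) : ‖F‖ ^ 2 = Var[F; μ] := by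
  rw [variance_of_integral_eq_zero (Lp.memLp F).1.aemeasurable hF, ← real_inner_self_eq_norm_sq,
    L2.inner_def]
  simp only [real_inner_self_eq_norm_sq, Real.norm_eq_abs, sq_abs]

theorem integral_evalL2 (hinv : P.Invariant π) (n : ℕ) (f : Lp ℝ 2 π) :
    ∫ ω, evalL2 hinv n f ω ∂chainLaw P π = ∫ x, f x ∂π := by
  have hn := measurePreserving_eval_chainLaw hinv n
  rw [integral_congr_ae (coeFn_evalL2 hinv n f), ← integral_map hn.measurable.aemeasurable
    (Lp.stronglyMeasurable f).aestronglyMeasurable, hn.map_eq]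

theorem norm_sum_evalL2_sq_eq_variance (hinv : P.Invariant π) {f : Lp ℝ 2 π}
    (hf : f ∈ centeredL2 π) (n : ℕ) :
    ‖∑ i ∈ Finset.range n, evalL2 hinv i f‖ ^ 2 =
      Var[fun ω => ∑ i ∈ Finset.range n, f (ω i); chainLaw P π] := by
  have hsum : (∑ i ∈ Finset.range n, evalL2 hinv i f : Lp ℝ 2 (chainLaw P π)) =ᵐ[chainLaw P π]
      fun ω => ∑ i ∈ Finset.range n, evalL2 hinv i f ω := by
    filter_upwards [Lp.coeFn_finsetSum (Finset.range n) (evalL2 hinv · f)] with ω hω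
    rw [hω, Finset.sum_apply]
  have hmean : ∫ ω, (∑ i ∈ Finset.range n, evalL2 hinv i f : Lp ℝ 2 (chainLaw P π)) ω
      ∂chainLaw P π = 0 := by
    rw [integral_congr_ae hsum,
      integral_finsetSum _ fun i _ => (Lp.memLp (evalL2 hinv i f)).integrable one_le_two]
    simp only [integral_evalL2, mem_centeredL2.1 hf, Finset.sum_const_zero]
  rw [norm_sq_eq_variance hmean]
  refine variance_congr ?_
  filter_upwards [hsum, ae_all_iff.2 (coeFn_evalL2 hinv · f)] with ω hω heval
  simp only [hω, heval]

theorem mem_centeredL2_of_ae_eq {h : S → ℝ} (hh : Integrable h π) {f : Lp ℝ 2 π}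
    (hf : f =ᵐ[π] fun x => h x - ∫ y, h y ∂π) : f ∈ centeredL2 π := by
  rw [mem_centeredL2, integral_congr_ae hf, integral_sub hh (integrable_const _),
    integral_const, probReal_univ, one_smul, sub_self]

theorem mul_variance_average_eq (hinv : P.Invariant π) {h : S → ℝ} (hh : Integrable h π)
    {f : Lp ℝ 2 π} (hf : f =ᵐ[π] fun x => h x - ∫ y, h y ∂π) (n : ℕ) :
    (n : ℝ) * Var[fun ω => (1 / (n : ℝ)) * ∑ i ∈ Finset.range n, h (ω i); chainLaw P π] =
      ‖∑ i ∈ Finset.range n, evalL2 hinv i f‖ ^ 2 / n := by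
  have hmeas : AEStronglyMeasurable (fun ω : ℕ → S => ∑ i ∈ Finset.range n, h (ω i))
      (chainLaw P π) := Finset.aestronglyMeasurable_fun_sum _ fun i _ =>
    hh.1.comp_measurePreserving (measurePreserving_eval_chainLaw hinv i)
  have hae : ∀ᵐ ω ∂chainLaw P π, ∀ i, f (ω i) = h (ω i) - ∫ x, h x ∂π :=
    ae_all_iff.2 fun i => (measurePreserving_eval_chainLaw hinv i).quasiMeasurePreserving.ae hf
  have hvar : Var[fun ω => ∑ i ∈ Finset.range n, h (ω i); chainLaw P π] =
      Var[fun ω => ∑ i ∈ Finset.range n, f (ω i); chainLaw P π] := by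
    rw [← variance_sub_const hmeas (n * ∫ x, h x ∂π)]
    refine variance_congr ?_
    filter_upwards [hae] with ω hω
    simp only [hω, Finset.sum_sub_distrib, Finset.sum_const, Finset.card_range, nsmul_eq_mul]
  rw [variance_const_mul, hvar,
    norm_sum_evalL2_sq_eq_variance hinv (mem_centeredL2_of_ae_eq hh hf)]
  rcases n.eq_zero_or_pos with rfl | hn
  · simp
  · field_simp

theorem varianceBounding_iff_forall_centeredL2 (hinv : P.Invariant π) :
    VarianceBounding P π ↔ ∀ f : centeredL2 π, ∃ s : ℝ,
      Tendsto (fun n : ℕ => ‖∑ i ∈ Finset.range n, evalL2 hinv i f‖ ^ 2 / n) atTop (𝓝 s) := by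
  simp only [VarianceBounding, HasAsymptoticVariance]
  constructor
  · intro hVB f
    have hcentered : (f : Lp ℝ 2 π) =ᵐ[π]
        fun x => (f : Lp ℝ 2 π) x - ∫ y, (f : Lp ℝ 2 π) y ∂π := by
      simp only [mem_centeredL2.1 f.2, sub_zero, EventuallyEq.rfl]
    simpa only [mul_variance_average_eq hinv ((Lp.memLp _).integrable one_le_two) hcentered]
      using hVB f (Lp.memLp _)
  · intro hlim h hh
    have hint := hh.integrable one_le_two
    have hcentered := (hh.sub (memLp_const (∫ y, h y ∂π))).coeFn_toLp
    simpa only [mul_variance_average_eq hinv hint hcentered]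
      using hlim ⟨_, mem_centeredL2_of_ae_eq hint hcentered⟩

theorem varianceBounding_iff_poincareInequality (hinv : P.Invariant π) :
    VarianceBounding P π ↔ PoincareInequality P π := by
  have hdil : IsMarkovDilation (centeredOperator hinv)
      fun n => (evalL2 hinv n).comp (centeredL2 π).subtypeₗᵢ :=
    fun i n hi f g => isMarkovDilation_evalL2 hinv hi (f : Lp ℝ 2 π) g
  rw [poincareInequality_iff_isCoercive hinv, hdil.isCoercive_iff,
    varianceBounding_iff_forall_centeredL2 hinv]
  rfl

end VarianceBounding

/-! ## Comparison of Metropolis-Hastings kernels -/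

section PoincareComparison

variable {S : Type*} [MeasurableSpace S]

theorem PoincareInequality.of_dirichletEnergy_le {P₁ P₂ : Kernel S S} {π : Measure S}
    (hle : ∀ ε : ℝ≥0, 0 < ε → ∃ C : ℝ≥0, ∀ f : S → ℝ, Measurable f →
      dirichletEnergy P₁ π f ≤ ε * ∫⁻ x, ‖f x‖ₑ ^ 2 ∂π + C * dirichletEnergy P₂ π f)
    (h : PoincareInequality P₁ π) : PoincareInequality P₂ π := by
  obtain ⟨c, hc, hgap⟩ := h
  obtain ⟨C, hC⟩ := hle (c / 2) (by positivity)
  refine ⟨c / 2 / (C + 1), by positivity, fun f hf hf2 hf0 => ?_⟩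
  set A := ∫⁻ x, ‖f x‖ₑ ^ 2 ∂π
  have hA : A ≠ ∞ := (ofReal_norm_toLp_sq hf2).symm.trans_ne ENNReal.ofReal_ne_top
  have habsorb : (c / 2 : ℝ≥0) * A ≤ C * dirichletEnergy P₂ π f := by
    refine ENNReal.le_of_add_le_add_left
      (ENNReal.mul_ne_top (ENNReal.coe_ne_top (r := c / 2)) hA) ?_
    calc (c / 2 : ℝ≥0) * A + (c / 2 : ℝ≥0) * A = c * A := by
          rw [← add_mul, ← ENNReal.coe_add, add_halves]
      _ ≤ (c / 2 : ℝ≥0) * A + C * dirichletEnergy P₂ π f := (hgap f hf hf2 hf0).trans (hC f hf)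
  calc (c / 2 / (C + 1) : ℝ≥0) * A = (c / 2 : ℝ≥0) * A / (C + 1 : ℝ≥0) := by
        rw [ENNReal.coe_div (by positivity), ENNReal.div_eq_inv_mul, ENNReal.div_eq_inv_mul,
          mul_assoc]
    _ ≤ dirichletEnergy P₂ π f := by
        refine ENNReal.div_le_of_le_mul' (habsorb.trans ?_)
        gcongr
        exact le_self_add

theorem lintegral_enorm_sub_sq_le_of_measurePreserving_swap {ρ : Measure (S × S)}
    (hρ : MeasurePreserving Prod.swap ρ ρ) {f : S → ℝ} (hf : Measurable f) :
    ∫⁻ z, ‖f z.1 - f z.2‖ₑ ^ 2 ∂ρ ≤ 4 * ∫⁻ x, ‖f x‖ₑ ^ 2 ∂ρ.fst := by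
  have hfst : ∫⁻ x, ‖f x‖ₑ ^ 2 ∂ρ.fst = ∫⁻ z, ‖f z.1‖ₑ ^ 2 ∂ρ :=
    lintegral_map (by fun_prop) measurable_fst
  have hsnd : ∫⁻ z, ‖f z.2‖ₑ ^ 2 ∂ρ = ∫⁻ z, ‖f z.1‖ₑ ^ 2 ∂ρ :=
    hρ.lintegral_comp (f := fun z => ‖f z.1‖ₑ ^ 2) (by fun_prop)
  calc ∫⁻ z, ‖f z.1 - f z.2‖ₑ ^ 2 ∂ρ
      ≤ ∫⁻ z, 2 * (‖f z.1‖ₑ ^ 2 + ‖f z.2‖ₑ ^ 2) ∂ρ := by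
        refine lintegral_mono fun z => ?_
        have h := ENNReal.rpow_add_le_mul_rpow_add_rpow ‖f z.1‖ₑ ‖f z.2‖ₑ one_le_two
        norm_num at h
        exact (pow_le_pow_left' enorm_sub_le 2).trans h
    _ = 4 * ∫⁻ x, ‖f x‖ₑ ^ 2 ∂ρ.fst := by
        rw [lintegral_const_mul _ (by fun_prop), lintegral_add_left (by fun_prop), hsnd, hfst]
        ring

end PoincareComparison

section MetropolisHastingsComparison

variable {S : Type*} [MeasurableSpace S] {μ : Measure S}

instance (π : TargetDensity S μ) : IsProbabilityMeasure π.toMeasure :=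
  ⟨by rw [TargetDensity.toMeasure, withDensity_apply _ MeasurableSet.univ, setLIntegral_univ,
    π.lintegral_dens]⟩

/-- The density `π(x) q(x, y) α(x, y) = min (π(x) q(x, y)) (π(y) q(y, x))` of the accepted moves of
a stationary Metropolis-Hastings chain. -/
def acceptedDensity (π : TargetDensity S μ) (Q : ProposalDensity S μ) (z : S × S) : ℝ≥0 :=
  min (π.dens z.1 * Q.dens z.1 z.2) (π.dens z.2 * Q.dens z.2 z.1)

theorem ProposalDensity.measurable_coe_dens (Q : ProposalDensity S μ) :
    Measurable fun z : S × S => (Q.dens z.1 z.2 : ℝ≥0∞) :=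
  Q.measurable_dens.coe_nnreal_ennreal

theorem measurable_acceptedDensity (π : TargetDensity S μ) (Q : ProposalDensity S μ) :
    Measurable (acceptedDensity π Q) :=
  ((π.measurable_dens.comp measurable_fst).mul Q.measurable_dens).min
    ((π.measurable_dens.comp measurable_snd).mul (Q.measurable_dens.comp measurable_swap))

theorem dens_mul_mhAccept (π : TargetDensity S μ) (Q : ProposalDensity S μ) (z : S × S) :
    π.dens z.1 * (Q.dens z.1 z.2 * mhAccept π Q z.1 z.2) = acceptedDensity π Q z := by
  unfold mhAccept acceptedDensity
  split_ifs with h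
  · rw [mul_one, h, min_eq_left zero_le]
  · rw [← mul_assoc, mul_min, mul_one, mul_div_cancel₀ _ h]

/-- The law of one step of the stationary Metropolis-Hastings chain, restricted to the accepted
moves. -/
noncomputable def acceptedMoves (π : TargetDensity S μ) (Q : ProposalDensity S μ) :
    Measure (S × S) :=
  (μ.prod μ).withDensity fun z => acceptedDensity π Q z

theorem restrict_compl_acceptedMoves_le {π : TargetDensity S μ} {Q₁ Q₂ : ProposalDensity S μ}
    {N : Set (S × S)} (hN : MeasurableSet N)
    (hswap : Prod.swap ⁻¹' N = N) {C : ℝ≥0}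
    (hC : ∀ᵐ x ∂π.toMeasure, ∀ y, (x, y) ∉ N → Q₁.dens x y ≤ C * Q₂.dens x y) :
    (acceptedMoves π Q₁).restrict Nᶜ ≤ C • acceptedMoves π Q₂ := by
  have hflow : ∀ᵐ x ∂μ, ∀ y, (x, y) ∉ N →
      π.dens x * Q₁.dens x y ≤ C * (π.dens x * Q₂.dens x y) := by
    rw [TargetDensity.toMeasure, ae_withDensity_iff π.measurable_dens.coe_nnreal_ennreal] at hC
    filter_upwards [hC] with x hx y hxy
    rw [mul_left_comm]
    rcases eq_or_ne (π.dens x) 0 with h0 | h0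
    · simp only [h0, zero_mul, le_refl]
    · gcongr
      exact hx (ENNReal.coe_ne_zero.2 h0) y hxy
  have hle : ∀ᵐ z ∂(μ.prod μ).restrict Nᶜ,
      (acceptedDensity π Q₁ z : ℝ≥0∞) ≤ C * acceptedDensity π Q₂ z := by
    rw [ae_restrict_iff' hN.compl]
    filter_upwards [Measure.quasiMeasurePreserving_fst.ae hflow,
      Measure.quasiMeasurePreserving_snd.ae hflow] with z hz₁ hz₂ hz
    rw [← ENNReal.coe_mul, ENNReal.coe_le_coe, acceptedDensity, acceptedDensity, mul_min]
    exact min_le_min (hz₁ z.2 hz) (hz₂ z.1 fun h => hz (hswap ▸ h))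
  calc (acceptedMoves π Q₁).restrict Nᶜ
      ≤ ((μ.prod μ).restrict Nᶜ).withDensity fun z => C * acceptedDensity π Q₂ z := by
        rw [acceptedMoves, restrict_withDensity hN.compl]
        exact withDensity_mono hle
    _ ≤ (μ.prod μ).withDensity fun z => C * acceptedDensity π Q₂ z := by
        rw [← restrict_withDensity hN.compl]
        exact Measure.restrict_le_self
    _ = C • acceptedMoves π Q₂ :=
        withDensity_smul _ (measurable_acceptedDensity π Q₂).coe_nnreal_ennreal

variable [SFinite μ] (π : TargetDensity S μ) (Q Q₁ Q₂ : ProposalDensity S μ)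

theorem measurePreserving_swap_acceptedMoves :
    MeasurePreserving Prod.swap (acceptedMoves π Q) (acceptedMoves π Q) := by
  refine ⟨measurable_swap, Measure.ext fun s hs => ?_⟩
  rw [Measure.map_apply measurable_swap hs, acceptedMoves,
    withDensity_apply _ (measurable_swap hs), withDensity_apply _ hs,
    ← Measure.measurePreserving_swap.setLIntegral_comp_preimage hs
      (measurable_acceptedDensity π Q).coe_nnreal_ennreal]
  refine lintegral_congr fun z => ?_
  simp only [acceptedDensity, Prod.fst_swap, Prod.snd_swap, min_comm]

theorem withDensity_toMeasure_prod {g : S × S → ℝ≥0∞} (hg : Measurable g) :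
    (π.toMeasure.prod μ).withDensity g = (μ.prod μ).withDensity fun z => π.dens z.1 * g z := by
  have hdens := π.measurable_dens.coe_nnreal_ennreal
  have hdens_fst : Measurable fun z : S × S => (π.dens z.1 : ℝ≥0∞) := hdens.comp measurable_fst
  rw [TargetDensity.toMeasure, prod_withDensity_left hdens, ← withDensity_mul _ hdens_fst hg]
  rfl

theorem acceptedMoves_le :
    acceptedMoves π Q ≤ (π.toMeasure.prod μ).withDensity fun z => Q.dens z.1 z.2 := by
  rw [withDensity_toMeasure_prod π Q.measurable_coe_dens]
  refine withDensity_mono (ae_of_all _ fun z => ?_)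
  dsimp only
  rw [← ENNReal.coe_mul, ENNReal.coe_le_coe]
  exact min_le_left _ _

theorem measurable_one_sub_mhMeanAccept_fst :
    Measurable fun z : S × S => 1 - mhMeanAccept π Q z.1 :=
  (measurable_const.sub (measurable_mhMeanAccept π Q)).comp measurable_fst

theorem compProd_mhKernel :
    π.toMeasure ⊗ₘ mhKernel π Q = acceptedMoves π Q +
      (π.toMeasure.map Function.diag).withDensity fun z => 1 - mhMeanAccept π Q z.1 := by
  have hacc : Measurable fun z : S × S => (Q.dens z.1 z.2 : ℝ≥0∞) * mhAccept π Q z.1 z.2 :=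
    measurable_mhFlow π Q
  have := Kernel.IsSFiniteKernel.withDensity (Kernel.const S μ)
    (f := fun x y => (Q.dens x y : ℝ≥0∞) * mhAccept π Q x y)
    fun _ _ => ENNReal.mul_ne_top ENNReal.coe_ne_top ENNReal.coe_ne_top
  have := Kernel.IsSFiniteKernel.withDensity
    (Kernel.deterministic (id : S → S) measurable_id) (f := fun x _ => 1 - mhMeanAccept π Q x)
    fun _ _ => ENNReal.sub_ne_top ENNReal.one_ne_top
  rw [mhKernel, Measure.compProd_add_right, Measure.compProd_withDensity hacc,
    Measure.compProd_withDensity (measurable_one_sub_mhMeanAccept_fst π Q), Measure.compProd_const,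
    ← Kernel.id, Measure.compProd_id, withDensity_toMeasure_prod π hacc]
  simp only [acceptedMoves, ← dens_mul_mhAccept, ENNReal.coe_mul]

theorem isReversible_mhKernel : (mhKernel π Q).IsReversible π.toMeasure := by
  intro A B hA hB
  have hdiag : Function.diag ⁻¹' (A ×ˢ B) = Function.diag ⁻¹' (B ×ˢ A) := by
    ext x
    exact and_comm
  have hrej := measurable_one_sub_mhMeanAccept_fst π Q
  rw [← Measure.compProd_apply_prod hA hB, ← Measure.compProd_apply_prod hB hA, compProd_mhKernel,
    Measure.add_apply, Measure.add_apply, ← Set.preimage_swap_prod,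
    (measurePreserving_swap_acceptedMoves π Q).measure_preimage (hB.prod hA).nullMeasurableSet,
    Set.preimage_swap_prod, withDensity_apply _ (hA.prod hB), withDensity_apply _ (hB.prod hA),
    setLIntegral_map (hA.prod hB) hrej (by fun_prop),
    setLIntegral_map (hB.prod hA) hrej (by fun_prop), hdiag]

theorem dirichletEnergy_mhKernel {f : S → ℝ} (hf : Measurable f) :
    dirichletEnergy (mhKernel π Q) π.toMeasure f =
      ∫⁻ z, ‖f z.1 - f z.2‖ₑ ^ 2 ∂acceptedMoves π Q := by
  have hrej := measurable_one_sub_mhMeanAccept_fst π Q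
  rw [dirichletEnergy, compProd_mhKernel, lintegral_add_measure,
    lintegral_withDensity_eq_lintegral_mul _ hrej (by fun_prop),
    lintegral_map (by fun_prop) (by fun_prop)]
  simp [Function.diag]

/-- Up to rare moves, the proposal `Q₁` is dominated by a multiple of `Q₂`: the moves in a symmetric
set `N` have small probability under `Q₁`, and the other moves have comparable densities. Only the
starting points charged by `ν` matter. -/
def ProposalDensity.AlmostDominated (Q₁ Q₂ : ProposalDensity S μ) (ν : Measure S) : Prop :=
  ∀ ε : ℝ≥0, 0 < ε → ∃ (C : ℝ≥0) (N : Set (S × S)), MeasurableSet N ∧ Prod.swap ⁻¹' N = N ∧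
    ∀ᵐ x ∂ν, ∫⁻ y in Prod.mk x ⁻¹' N, Q₁.dens x y ∂μ ≤ ε ∧
      ∀ y, (x, y) ∉ N → Q₁.dens x y ≤ C * Q₂.dens x y

variable {π Q₁ Q₂}

theorem fst_restrict_acceptedMoves_le {N : Set (S × S)} (hN : MeasurableSet N) {ε : ℝ≥0}
    (hε : ∀ᵐ x ∂π.toMeasure, ∫⁻ y in Prod.mk x ⁻¹' N, Q₁.dens x y ∂μ ≤ ε) :
    ((acceptedMoves π Q₁).restrict N).fst ≤ ε • π.toMeasure := by
  refine Measure.le_iff.2 fun s hs => ?_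
  have hsN : MeasurableSet (Prod.fst ⁻¹' s ∩ N) := (measurable_fst hs).inter hN
  calc ((acceptedMoves π Q₁).restrict N).fst s
      = acceptedMoves π Q₁ (Prod.fst ⁻¹' s ∩ N) := by
        rw [Measure.fst_apply hs, Measure.restrict_apply (measurable_fst hs)]
    _ ≤ ∫⁻ z in Prod.fst ⁻¹' s ∩ N, Q₁.dens z.1 z.2 ∂π.toMeasure.prod μ := by
        rw [← withDensity_apply _ hsN]
        exact acceptedMoves_le π Q₁ _
    _ = ∫⁻ x in s, ∫⁻ y in Prod.mk x ⁻¹' N, Q₁.dens x y ∂μ ∂π.toMeasure := by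
        rw [Set.inter_comm, ← Measure.restrict_restrict hN, ← lintegral_indicator hN,
          ← Set.prod_univ, ← Measure.restrict_prod_eq_prod_univ,
          lintegral_prod _ (Q₁.measurable_coe_dens.indicator hN).aemeasurable]
        simp only [← lintegral_indicator (measurable_prodMk_left hN)]
        rfl
    _ ≤ ∫⁻ _ in s, ε ∂π.toMeasure := lintegral_mono_ae (ae_restrict_of_ae hε)
    _ = (ε • π.toMeasure) s := setLIntegral_const _ _

theorem PoincareInequality.of_almostDominated (hQ : Q₁.AlmostDominated Q₂ π.toMeasure)
    (h : PoincareInequality (mhKernel π Q₁) π.toMeasure) :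
    PoincareInequality (mhKernel π Q₂) π.toMeasure := by
  refine h.of_dirichletEnergy_le fun ε hε => ?_
  obtain ⟨C, N, hN, hswap, hdom⟩ := hQ (ε / 4) (by positivity)
  have hrare := fst_restrict_acceptedMoves_le hN (hdom.mono fun x hx => hx.1)
  have hcomp := restrict_compl_acceptedMoves_le hN hswap (hdom.mono fun x hx => hx.2)
  have hsymm : MeasurePreserving Prod.swap ((acceptedMoves π Q₁).restrict N)
      ((acceptedMoves π Q₁).restrict N) := by
    simpa only [hswap] using (measurePreserving_swap_acceptedMoves π Q₁).restrict_preimage hN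
  refine ⟨C, fun f hf => ?_⟩
  rw [dirichletEnergy_mhKernel π Q₁ hf, dirichletEnergy_mhKernel π Q₂ hf,
    ← lintegral_add_compl _ hN]
  refine add_le_add ?_ ?_
  · calc ∫⁻ z in N, ‖f z.1 - f z.2‖ₑ ^ 2 ∂acceptedMoves π Q₁
        ≤ 4 * ∫⁻ x, ‖f x‖ₑ ^ 2 ∂((acceptedMoves π Q₁).restrict N).fst :=
          lintegral_enorm_sub_sq_le_of_measurePreserving_swap hsymm hf
      _ ≤ 4 * ∫⁻ x, ‖f x‖ₑ ^ 2 ∂((ε / 4) • π.toMeasure) := by gcongr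
      _ = ε * ∫⁻ x, ‖f x‖ₑ ^ 2 ∂π.toMeasure := by
          rw [lintegral_smul_measure, ENNReal.smul_def, smul_eq_mul, ← mul_assoc,
            ENNReal.coe_div four_ne_zero, ENNReal.coe_ofNat,
            ENNReal.mul_div_cancel four_ne_zero ENNReal.ofNat_ne_top]
  · calc ∫⁻ z in Nᶜ, ‖f z.1 - f z.2‖ₑ ^ 2 ∂acceptedMoves π Q₁
        ≤ ∫⁻ z, ‖f z.1 - f z.2‖ₑ ^ 2 ∂(C • acceptedMoves π Q₂) := by gcongr
      _ = C * ∫⁻ z, ‖f z.1 - f z.2‖ₑ ^ 2 ∂acceptedMoves π Q₂ := lintegral_smul_measure _ _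

end MetropolisHastingsComparison

/-! ## Gaussian proposals -/

section GaussianProposals

theorem exists_ae_norm_le_of_essSup_lt_top {S E : Type*} [MeasurableSpace S]
    [SeminormedAddCommGroup E] {ν : Measure S} {v : S → E}
    (hv : essSup (fun x => ‖v x‖ₑ) ν < ∞) : ∃ M : ℝ, ∀ᵐ x ∂ν, ‖v x‖ ≤ M := by
  refine ⟨(essSup (fun x => ‖v x‖ₑ) ν).toReal, ?_⟩
  filter_upwards [ae_le_essSup (μ := ν) (f := fun x => ‖v x‖ₑ)] with x hx
  rw [← toReal_enorm]
  exact ENNReal.toReal_mono hv.ne hx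

variable {d : ℕ}

theorem gaussianDensity_eq_sub (m : EuclideanSpace ℝ (Fin d)) (σ : ℝ)
    (y : EuclideanSpace ℝ (Fin d)) : gaussianDensity m σ y = gaussianDensity 0 σ (y - m) := by
  simp only [gaussianDensity, sub_zero]

theorem measurable_gaussianDensity (m : EuclideanSpace ℝ (Fin d)) (σ : ℝ) :
    Measurable (gaussianDensity m σ) := by
  unfold gaussianDensity
  fun_prop

theorem gaussianDensity_le (m : EuclideanSpace ℝ (Fin d)) (σ : ℝ) (y : EuclideanSpace ℝ (Fin d)) :
    gaussianDensity m σ y ≤ (2 * Real.pi * σ ^ 2) ^ (-(d : ℝ) / 2) := by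
  unfold gaussianDensity
  refine mul_le_of_le_one_right (by positivity) (Real.exp_le_one_iff.2 ?_)
  rw [neg_mul, neg_nonpos]
  positivity

theorem le_gaussianDensity {m y : EuclideanSpace ℝ (Fin d)} (σ : ℝ) {R : ℝ} (hR : ‖y - m‖ ≤ R) :
    (2 * Real.pi * σ ^ 2) ^ (-(d : ℝ) / 2) * Real.exp (-(1 / (2 * σ ^ 2)) * R ^ 2)
      ≤ gaussianDensity m σ y := by
  unfold gaussianDensity
  rw [neg_mul, neg_mul]
  gcongr

theorem exists_gaussianDensity_le_mul (σ₁ : ℝ) {σ₂ : ℝ} (hσ₂ : 0 < σ₂) (R : ℝ) :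
    ∃ C : ℝ≥0, ∀ m₁ m₂ y : EuclideanSpace ℝ (Fin d), ‖y - m₂‖ ≤ R →
      (gaussianDensity m₁ σ₁ y).toNNReal ≤ C * (gaussianDensity m₂ σ₂ y).toNNReal := by
  set a := (2 * Real.pi * σ₁ ^ 2) ^ (-(d : ℝ) / 2)
  set b := (2 * Real.pi * σ₂ ^ 2) ^ (-(d : ℝ) / 2) * Real.exp (-(1 / (2 * σ₂ ^ 2)) * R ^ 2)
  have hb : 0 < b := by positivity
  have hab : 0 ≤ a / b := div_nonneg (by positivity) hb.le
  refine ⟨(a / b).toNNReal, fun m₁ m₂ y hy => ?_⟩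
  rw [← Real.toNNReal_mul hab]
  refine Real.toNNReal_le_toNNReal ?_
  calc gaussianDensity m₁ σ₁ y ≤ a := gaussianDensity_le m₁ σ₁ y
    _ = a / b * b := (div_mul_cancel₀ a hb.ne').symm
    _ ≤ a / b * gaussianDensity m₂ σ₂ y := by
        gcongr
        exact le_gaussianDensity σ₂ hy

theorem exists_setLIntegral_gaussianDensity_le {σ : ℝ} (hσ : 0 < σ) {ε : ℝ≥0∞} (hε : 0 < ε) :
    ∃ r : ℝ, ∫⁻ z in {z : EuclideanSpace ℝ (Fin d) | r < ‖z‖},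
      ENNReal.ofReal (gaussianDensity 0 σ z) ≤ ε := by
  set ρ : Measure (EuclideanSpace ℝ (Fin d)) :=
    volume.withDensity fun z => ENNReal.ofReal (gaussianDensity 0 σ z) with hρ
  have : IsFiniteMeasure ρ :=
    isFiniteMeasure_withDensity ((lintegral_gaussianDensity 0 hσ).trans_ne ENNReal.one_ne_top)
  have htail := tendsto_measure_norm_gt_of_isTightMeasureSet (isTightMeasureSet_singleton (μ := ρ))
  simp only [Set.mem_singleton_iff, iSup_iSup_eq_left] at htail
  obtain ⟨r, hr⟩ := (htail.eventually_le_const hε).exists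
  refine ⟨r, ?_⟩
  rwa [hρ, withDensity_apply _ (measurableSet_lt measurable_const measurable_norm)] at hr

theorem map_pos_lebesgueOn_le (X : Set (EuclideanSpace ℝ (Fin d))) :
    (lebesgueOn X).map LebesgueSpace.pos ≤ volume :=
  Measure.le_iff.2 fun s hs => by
    rw [Measure.map_apply LebesgueSpace.measurable_pos hs]
    exact lebesgueOn_preimage_le X hs

variable {X : Set (EuclideanSpace ℝ (Fin d))}

theorem setLIntegral_gaussianProposal_le {v : LebesgueSpace X → EuclideanSpace ℝ (Fin d)}
    (hv : Measurable v) {σ : ℝ} (hσ : 0 < σ) (r : ℝ) {M : ℝ} {x : LebesgueSpace X}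
    (hx : ‖v x‖ ≤ M) :
    ∫⁻ y in {y | r + M < ‖x.pos - y.pos‖}, (gaussianProposal X v hv σ hσ).dens x y ∂lebesgueOn X ≤
      ∫⁻ z in {z : EuclideanSpace ℝ (Fin d) | r < ‖z‖}, ENNReal.ofReal (gaussianDensity 0 σ z) := by
  set m := x.pos + v x with hm
  have hsub : {y : LebesgueSpace X | r + M < ‖x.pos - y.pos‖} ⊆
      LebesgueSpace.pos ⁻¹' {y | r < ‖y - m‖} := fun y (hy : r + M < ‖x.pos - y.pos‖) => by
    have htri : ‖x.pos - y.pos‖ ≤ ‖m - y.pos‖ + ‖v x‖ := by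
      refine (congrArg norm ?_).trans_le (norm_sub_le _ _)
      rw [hm, add_sub_right_comm, add_sub_cancel_right]
    rw [norm_sub_rev m] at htri
    exact Set.mem_preimage.2 (show r < ‖y.pos - m‖ by linarith)
  have hball : MeasurableSet {y | r < ‖y - m‖} := measurableSet_lt (by fun_prop) (by fun_prop)
  calc ∫⁻ y in {y | r + M < ‖x.pos - y.pos‖}, (gaussianProposal X v hv σ hσ).dens x y ∂lebesgueOn X
      ≤ ∫⁻ y in LebesgueSpace.pos ⁻¹' {y | r < ‖y - m‖},
          ENNReal.ofReal (gaussianDensity m σ y.pos) ∂lebesgueOn X := lintegral_mono_set hsub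
    _ = ∫⁻ y in {y | r < ‖y - m‖}, ENNReal.ofReal (gaussianDensity m σ y)
          ∂(lebesgueOn X).map LebesgueSpace.pos :=
        (setLIntegral_map hball (measurable_gaussianDensity m σ).ennreal_ofReal
          LebesgueSpace.measurable_pos).symm
    _ ≤ ∫⁻ y in {y | r < ‖y - m‖}, ENNReal.ofReal (gaussianDensity m σ y) := by
        gcongr
        exact map_pos_lebesgueOn_le X
    _ = ∫⁻ z in {z | r < ‖z‖}, ENNReal.ofReal (gaussianDensity 0 σ z) := by
        simp only [gaussianDensity_eq_sub m]
        exact (measurePreserving_sub_right volume m).setLIntegral_comp_preimage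
          (measurableSet_lt measurable_const measurable_norm)
          (measurable_gaussianDensity 0 σ).ennreal_ofReal

theorem almostDominated_gaussianProposal {v₁ v₂ : LebesgueSpace X → EuclideanSpace ℝ (Fin d)}
    (hv₁ : Measurable v₁) (hv₂ : Measurable v₂) {σ₁ σ₂ : ℝ} (hσ₁ : 0 < σ₁) (hσ₂ : 0 < σ₂)
    {ν : Measure (LebesgueSpace X)} (hbdd₁ : essSup (fun x => ‖v₁ x‖ₑ) ν < ∞)
    (hbdd₂ : essSup (fun x => ‖v₂ x‖ₑ) ν < ∞) :
    (gaussianProposal X v₁ hv₁ σ₁ hσ₁).AlmostDominated (gaussianProposal X v₂ hv₂ σ₂ hσ₂) ν := by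
  intro ε hε
  obtain ⟨M₁, hM₁⟩ := exists_ae_norm_le_of_essSup_lt_top hbdd₁
  obtain ⟨M₂, hM₂⟩ := exists_ae_norm_le_of_essSup_lt_top hbdd₂
  obtain ⟨r, hr⟩ := exists_setLIntegral_gaussianDensity_le (d := d) hσ₁ (ENNReal.coe_pos.2 hε)
  obtain ⟨C, hC⟩ := exists_gaussianDensity_le_mul (d := d) σ₁ hσ₂ (r + M₁ + M₂)
  have hpos : Measurable (LebesgueSpace.pos (X := X)) := LebesgueSpace.measurable_pos
  refine ⟨C, {z | r + M₁ < ‖z.1.pos - z.2.pos‖}, ?_, ?_, ?_⟩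
  · exact measurableSet_lt measurable_const
      ((hpos.comp measurable_fst).sub (hpos.comp measurable_snd)).norm
  · ext z
    simp only [Set.mem_preimage, Set.mem_ofPred_eq, Prod.fst_swap, Prod.snd_swap, norm_sub_rev]
  · filter_upwards [hM₁, hM₂] with x hx₁ hx₂
    refine ⟨(setLIntegral_gaussianProposal_le hv₁ hσ₁ r hx₁).trans hr, fun y hxy => hC _ _ _ ?_⟩
    have hmove : ‖y.pos - x.pos‖ ≤ r + M₁ := norm_sub_rev x.pos y.pos ▸ not_lt.1 hxy
    rw [← sub_sub]
    exact (norm_sub_le _ _).trans (add_le_add hmove hx₂)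

end GaussianProposals

theorem proposition4 {d : ℕ} (X : Set (EuclideanSpace ℝ (Fin d)))
    (hX : NullMeasurableSet X volume)
    (π : TargetDensity (LebesgueSpace X) (lebesgueOn X))
    (v : LebesgueSpace X → EuclideanSpace ℝ (Fin d)) (hv : Measurable v)
    (hv_bdd : essSup (fun x => ‖v x‖ₑ) π.toMeasure < ⊤)
    (lam : ℝ) (hlam : 0 < lam) (σ : ℝ) (hσ : 0 < σ) :
    VarianceBounding (mhKernel π (rwmProposal X lam hlam)) π.toMeasure ↔
      VarianceBounding (mhKernel π (gaussianProposal X v hv σ hσ)) π.toMeasure := by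
  have hzero_bdd : essSup (fun _ => ‖(0 : EuclideanSpace ℝ (Fin d))‖ₑ) π.toMeasure < ∞ := by
    simp only [enorm_zero]
    exact (essSup_le_of_ae_le 0 EventuallyLE.rfl).trans_lt ENNReal.zero_lt_top
  rw [varianceBounding_iff_poincareInequality (isReversible_mhKernel π _).invariant,
    varianceBounding_iff_poincareInequality (isReversible_mhKernel π _).invariant]
  exact ⟨.of_almostDominated
      (almostDominated_gaussianProposal measurable_const hv hlam hσ hzero_bdd hv_bdd),
    .of_almostDominated
      (almostDominated_gaussianProposal hv measurable_const hσ hlam hv_bdd hzero_bdd)⟩
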